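/- Let $T>0$, $\mu,\sigma\in\mathbb R$, and let $(\Omega,\mathcal F,(\mathcal F_t)_{0\le t\le T},P)$ be a filtered probability space. Let $W$ be a Wiener process on $[0,T]$ relative to $(\mathcal F_t)$, i.e. $W$ is almost surely continuous, $W(0)=0$ almost surely, and $W$ is a square-integrable $\mathcal F_t$-martingale with $\mathbb E[(W(t)-W(s))^2\mid\mathcal F_s]=t-s$ for $0\le s\le t\le T$. Let $X$ be an almost surely continuous adapted solution on $[0,T]$ of the Itô equation of geometric Brownian motion $$dX(t)=\mu X(t)\,dt+\sigma X(t)\,dW(t),\qquad \mathbb E|X(0)|^2<\infty .$$ For a step $\Delta t>0$ put $t_i=i\Delta t$, $\Delta W_{2n}=W(t_{2n+1})-W(t_{2n})$ and $(E^2-1)W_{2n}=W(t_{2n+2})-W(t_{2n})$. The scheme is $\tilde X_{2n+1}=\alpha_n\tilde X_{2n}$, $\tilde X_{2n+2}=\beta_n\tilde X_{2n}$ with $$\alpha_n=\frac{1-\frac{(\mu\Delta t)^2}{6}-\sigma\frac{\mu\Delta t}{12}(E^2-1)W_{2n}+\sigma\bigl(1-\frac{\mu\Delta t}{3}\bigr)\Delta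 W_{2n}}{1-\mu\Delta t+\frac{(\mu\Delta t)^2}{3}},\qquad \beta_n=\frac{1+\frac{\mu\Delta t}{3}+\frac{4\mu\Delta t}{3}\alpha_n+\sigma(E^2-1)W_{2n}}{1-\frac{\mu\Delta t}{3}} .$$ For $\mu\Delta t\ne3$ these $\tilde X_{2n+1},\tilde X_{2n+2}$ are the solution of the two implicit equations $$\tilde X_{2n+1}=\tilde X_{2n}+\mu\Bigl(\tfrac{5\Delta t}{12}\tilde X_{2n}+\tfrac{2\Delta t}{3}\tilde X_{2n+1}-\tfrac{\Delta t}{12}\tilde X_{2n+2}\Bigr)+\sigma\tilde X_{2n}\,\Delta W_{2n},$$ $$\tilde X_{2n+2}=\tilde X_{2n}+\mu\int_{t_{2n}}^{t_{2n+2}}\tilde q_n(t)\,dt+\sigma\tilde X_{2n}\,(E^2-1)W_{2n},$$ where $\tilde q_n$ is the quadratic polynomial with $\tilde q_n(t_j)=\tilde X_j$ for $j=2n,2n+1,2n+2$. The scheme is mean-square consistent, with respect to both of the following notions of local error $\delta_j=X(t_j)-\tilde X(t_j)$, $j\in\{2n+1,2n+2\}$: (a) $\tilde X(t_j)$ is the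 result of one step of the scheme started from the exact value at $t_{2n}$, that is, $\tilde X(t_{2n+1})=\alpha_nX(t_{2n})$ and $\tilde X(t_{2n+2})=\beta_nX(t_{2n})$; (b) $\tilde X(t_j)$ is the right-hand side of the corresponding implicit equation with the exact values $X(t_{2n}),X(t_{2n+1}),X(t_{2n+2})$ in place of $\tilde X_{2n},\tilde X_{2n+1},\tilde X_{2n+2}$. Precisely: there exist $k>0$ and $h_0>0$ such that for every $\Delta t\in(0,h_0)$ and every integer $n\ge0$ with $t_{2n+2}\le T$, the errors $\delta_{2n+1}$ and $\delta_{2n+2}$, in each of the senses (a) and (b), are square integrable and satisfy $$\mathbb E|\delta_{2n+1}|^2\le k\,\Delta t,\qquad \mathbb E|\delta_{2n+2}|^2\le k\,\Delta t .$$ -/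

import Mathlib

open MeasureTheory ProbabilityTheory Filter Topology

namespace GBM

/-- The left-endpoint sum `∑_{i<m} H(τᵢ) (W(τᵢ₊₁) - W(τᵢ))` along the points `τ₀, …, τₘ`. -/
noncomputable def leftSum {Ω : Type*} (W H : ℝ → Ω → ℝ) (m : ℕ) (τ : ℕ → ℝ) (ω : Ω) : ℝ :=
  ∑ i ∈ Finset.range m, H (τ i) ω * (W (τ (i + 1)) ω - W (τ i) ω)

/-- `I` is (a version of) the Itô integral `∫ₐᵇ H dW` of a process `H` that is adapted and
continuous on `[a, b]`: along every sequence of partitions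
`a = τ₀ ≤ τ₁ ≤ … ≤ τₘ = b` whose mesh tends to `0`, the left-endpoint sums converge to `I` in
probability. -/
def IsItoIntegral {Ω : Type*} [MeasurableSpace Ω] (P : Measure Ω) (W H : ℝ → Ω → ℝ) (a b : ℝ)
    (I : Ω → ℝ) : Prop :=
  ∀ (m : ℕ → ℕ) (τ : ℕ → ℕ → ℝ) (ε : ℕ → ℝ),
    (∀ k, Monotone (τ k) ∧ τ k 0 = a ∧ τ k (m k) = b) →
    (∀ k, ∀ i < m k, τ k (i + 1) - τ k i ≤ ε k) →
    Tendsto ε atTop (𝓝 0) →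
    TendstoInMeasure P (fun k => leftSum W H (m k) (τ k)) atTop I

/-- `W` is a Wiener process on `[0, T]` relative to the filtration `𝓕`: almost surely continuous,
started at `0`, and a (square integrable) `𝓕`-martingale with
`E[(W(t) - W(s))² | 𝓕ₛ] = t - s` for `s ≤ t`. Values `W t` with `t` outside `[0, T]` play
no role. -/
structure IsWiener {Ω : Type*} [MeasurableSpace Ω] (P : Measure Ω) (T : ℝ)
    (𝓕 : Filtration (Set.Icc (0 : ℝ) T) ‹MeasurableSpace Ω›) (W : ℝ → Ω → ℝ) : Prop where
  continuous_paths : ∀ᵐ ω ∂P, ContinuousOn (fun t => W t ω) (Set.Icc 0 T)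
  zero : ∀ᵐ ω ∂P, W 0 ω = 0
  martingale : Martingale (fun (t : Set.Icc (0 : ℝ) T) => W t) 𝓕 P
  integrable_sq : ∀ t : Set.Icc (0 : ℝ) T, Integrable (fun ω => W t ω ^ 2) P
  condVariance : ∀ s t : Set.Icc (0 : ℝ) T, s ≤ t →
    P[fun ω => (W t ω - W s ω) ^ 2 | 𝓕 s] =ᵐ[P] fun _ => (t : ℝ) - s

/-- `X` is a solution on `[0, T]` of `dX = μ X dt + σ X dW`: almost surely continuous, adapted
to `𝓕`, and, for each `t ∈ [0, T]`, almost surely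
`X(t) = X(0) + ∫₀ᵗ μ X(s) ds + ∫₀ᵗ σ X(s) dW(s)`, the last integral being an Itô integral. -/
structure IsSolution {Ω : Type*} [MeasurableSpace Ω] (P : Measure Ω) (T μ σ : ℝ)
    (𝓕 : Filtration (Set.Icc (0 : ℝ) T) ‹MeasurableSpace Ω›) (W X : ℝ → Ω → ℝ) : Prop where
  continuous_paths : ∀ᵐ ω ∂P, ContinuousOn (fun t => X t ω) (Set.Icc 0 T)
  adapted : StronglyAdapted 𝓕 (fun (t : Set.Icc (0 : ℝ) T) => X t)
  integral_eq : ∀ t ∈ Set.Icc (0 : ℝ) T, ∃ I : Ω → ℝ,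
    IsItoIntegral P W (fun s ω => σ * X s ω) 0 t I ∧
    ∀ᵐ ω ∂P, X t ω = X 0 ω + (∫ s in (0 : ℝ)..t, μ * X s ω) + I ω

/-- The grid point `tᵢ = i Δt`. -/
def grid (Δt : ℝ) (i : ℕ) : ℝ := i * Δt

/-- The increment `ΔW₂ₙ = W(t₂ₙ₊₁) - W(t₂ₙ)`. -/
def incr1 {Ω : Type*} (Δt : ℝ) (W : ℝ → Ω → ℝ) (n : ℕ) (ω : Ω) : ℝ :=
  W (grid Δt (2 * n + 1)) ω - W (grid Δt (2 * n)) ω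

/-- The double increment `(E² - 1)W₂ₙ = W(t₂ₙ₊₂) - W(t₂ₙ)`. -/
def incr2 {Ω : Type*} (Δt : ℝ) (W : ℝ → Ω → ℝ) (n : ℕ) (ω : Ω) : ℝ :=
  W (grid Δt (2 * n + 2)) ω - W (grid Δt (2 * n)) ω

/-- The random factor `αₙ` of the scheme, `X̃₂ₙ₊₁ = αₙ X̃₂ₙ`. -/
noncomputable def alpha {Ω : Type*} (μ σ Δt : ℝ) (W : ℝ → Ω → ℝ) (n : ℕ) (ω : Ω) : ℝ :=
  (1 - (μ * Δt) ^ 2 / 6 - σ * (μ * Δt / 12) * incr2 Δt W n ω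
      + σ * (1 - μ * Δt / 3) * incr1 Δt W n ω)
    / (1 - μ * Δt + (μ * Δt) ^ 2 / 3)

/-- The random factor `βₙ` of the scheme, `X̃₂ₙ₊₂ = βₙ X̃₂ₙ`. -/
noncomputable def beta {Ω : Type*} (μ σ Δt : ℝ) (W : ℝ → Ω → ℝ) (n : ℕ) (ω : Ω) : ℝ :=
  (1 + μ * Δt / 3 + 4 * μ * Δt / 3 * alpha μ σ Δt W n ω + σ * incr2 Δt W n ω)
    / (1 - μ * Δt / 3)

/-- The quadratic polynomial in `t` that interpolates the path of `X` at the points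
`t₂ₙ, t₂ₙ₊₁, t₂ₙ₊₂`, in Lagrange form. -/
noncomputable def interp {Ω : Type*} (Δt : ℝ) (X : ℝ → Ω → ℝ) (n : ℕ) (ω : Ω) (t : ℝ) : ℝ :=
  (t - grid Δt (2 * n + 1)) * (t - grid Δt (2 * n + 2)) / (2 * Δt ^ 2) * X (grid Δt (2 * n)) ω
  + (t - grid Δt (2 * n)) * (t - grid Δt (2 * n + 2)) / (-Δt ^ 2) * X (grid Δt (2 * n + 1)) ω
  + (t - grid Δt (2 * n)) * (t - grid Δt (2 * n + 1)) / (2 * Δt ^ 2) * X (grid Δt (2 * n + 2)) ω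

/-- Local error at `t₂ₙ₊₁` of the scheme: the exact value minus the result of one step of the
scheme started from the exact value at `t₂ₙ`. -/
noncomputable def stepError1 {Ω : Type*} (μ σ Δt : ℝ) (W X : ℝ → Ω → ℝ) (n : ℕ) (ω : Ω) : ℝ :=
  X (grid Δt (2 * n + 1)) ω - alpha μ σ Δt W n ω * X (grid Δt (2 * n)) ω

/-- Local error at `t₂ₙ₊₂` of the scheme: the exact value minus the result of one step of the
scheme started from the exact value at `t₂ₙ`. -/
noncomputable def stepError2 {Ω : Type*} (μ σ Δt : ℝ) (W X : ℝ → Ω → ℝ) (n : ℕ) (ω : Ω) : ℝ :=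
  X (grid Δt (2 * n + 2)) ω - beta μ σ Δt W n ω * X (grid Δt (2 * n)) ω

/-- Local error at `t₂ₙ₊₁` when the exact solution is inserted in the right-hand side of the
implicit equation of the scheme for `t₂ₙ₊₁`. -/
noncomputable def residual1 {Ω : Type*} (μ σ Δt : ℝ) (W X : ℝ → Ω → ℝ) (n : ℕ) (ω : Ω) : ℝ :=
  X (grid Δt (2 * n + 1)) ω -
    (X (grid Δt (2 * n)) ω
      + μ * (5 * Δt / 12 * X (grid Δt (2 * n)) ω + 2 * Δt / 3 * X (grid Δt (2 * n + 1)) ω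
          - Δt / 12 * X (grid Δt (2 * n + 2)) ω)
      + σ * X (grid Δt (2 * n)) ω * incr1 Δt W n ω)

/-- Local error at `t₂ₙ₊₂` when the exact solution is inserted in the right-hand side of the
implicit equation of the scheme for `t₂ₙ₊₂`. -/
noncomputable def residual2 {Ω : Type*} (μ σ Δt : ℝ) (W X : ℝ → Ω → ℝ) (n : ℕ) (ω : Ω) : ℝ :=
  X (grid Δt (2 * n + 2)) ω -
    (X (grid Δt (2 * n)) ω
      + μ * (∫ t in (grid Δt (2 * n))..(grid Δt (2 * n + 2)), interp Δt X n ω t)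
      + σ * X (grid Δt (2 * n)) ω * incr2 Δt W n ω)

/-- `δ` is square integrable and `E|δ|² ≤ c`. -/
def MeanSquareLE {Ω : Type*} [MeasurableSpace Ω] (P : Measure Ω) (δ : Ω → ℝ) (c : ℝ) : Prop :=
  MemLp δ 2 P ∧ ∫ ω, |δ ω| ^ 2 ∂P ≤ c

end GBM

/-!
The errors are only claimed to be of order `Δt` in mean square, so no cancellation between the
scheme and the stochastic Taylor expansion of `X` is needed. Each of the four errors is a linear
combination, with deterministic coefficients bounded uniformly in `Δt` and `n`, of
`X(t₂ₙ₊₁) - X(t₂ₙ)`, `X(t₂ₙ₊₂) - X(t₂ₙ)`, `Δt X(t₂ₙ)` and the products of `X(t₂ₙ)` with the two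
increments of `W` (`GBM.IsErrorCombination`). For the step errors this holds because `αₙ - 1` is
of first order (`GBM.alpha_eq`) and its denominator is at least `1 / 4`; for the residuals, the
integral of the interpolating polynomial is Simpson's rule (`GBM.integral_interp`).

It remains to show that `E X(t)²` is bounded on `[0, T]`, that `E (X(t) - X(s))² ≤ C (t - s)`, and
that `E (X(s) (W(t) - W(s)))² ≤ C (t - s)` (`GBM.IsSolution.exists_moment_bounds`). The last bound
follows from the first by pulling `X(s)` out of the conditional variance. For the others,
`X(t) - X(s)` is, along a subsequence, the almost sure limit of the sums
`∑ X(rⱼ) (μ (rⱼ₊₁ - rⱼ) + σ (W(rⱼ₊₁) - W(rⱼ)))` over uniform partitions of `[s, t]`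
(`GBM.IsSolution.exists_tendsto_eulerSum`), and the second moments of such sums are controlled by
orthogonality of martingale increments (`GBM.IsWiener.meanSquareLE_eulerSum`); Fatou's lemma carries
the bounds to the limit.

A solution is not assumed to be square integrable after time `0`, so the argument is run for the
process truncated when its path leaves `[-R, R]`. With `g(t)` the second moment of the truncated
process, the limit gives `g(t) ≤ 2 g(s) + 2 K (t - s) sup g`, where the supremum over `[s, t]` is
finite and is absorbed if `t - s` is small (`GBM.IsSolution.meanSquareLE_trunc_step`). Finitely many
such steps cover `[0, T]`, with constants independent of `R`, and `R → ∞` concludes.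
-/

namespace GBM

/-! ### Mean-square bounds -/

section MeanSquare

variable {Ω : Type*} [MeasurableSpace Ω] {P : Measure Ω} {f g : Ω → ℝ} {a b c : ℝ}

lemma MeanSquareLE.nonneg (h : MeanSquareLE P f a) : 0 ≤ a :=
  (integral_nonneg fun _ => by positivity).trans h.2

lemma MeanSquareLE.integrable_sq (h : MeanSquareLE P f a) :
    Integrable (fun ω => |f ω| ^ 2) P := by
  simpa using h.1.integrable_sq

lemma MeanSquareLE.mono (h : MeanSquareLE P f a) (hab : a ≤ b) : MeanSquareLE P f b :=
  ⟨h.1, h.2.trans hab⟩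

lemma MeanSquareLE.congr (h : MeanSquareLE P f a) (hfg : f =ᵐ[P] g) : MeanSquareLE P g a := by
  refine ⟨h.1.ae_eq hfg, le_of_eq_of_le (integral_congr_ae ?_) h.2⟩
  filter_upwards [hfg] with ω hω
  rw [hω]

/-- The form of a mean-square bound to which Fatou's lemma applies. -/
lemma meanSquareLE_iff_lintegral (hc : 0 ≤ c) :
    MeanSquareLE P f c ↔
      AEStronglyMeasurable f P ∧ ∫⁻ ω, ENNReal.ofReal (|f ω| ^ 2) ∂P ≤ ENNReal.ofReal c := by
  have hn : 0 ≤ᵐ[P] fun ω => |f ω| ^ 2 := ae_of_all _ fun ω => by positivity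
  constructor
  · intro h
    refine ⟨h.1.aestronglyMeasurable, ?_⟩
    rw [← ofReal_integral_eq_lintegral_ofReal h.integrable_sq hn]
    exact ENNReal.ofReal_le_ofReal h.2
  · rintro ⟨hm, h⟩
    have hi : Integrable (fun ω => |f ω| ^ 2) P := by
      refine ⟨(hm.pow 2).congr (ae_of_all _ fun ω => by simp), ?_⟩
      rw [hasFiniteIntegral_iff_ofReal hn]
      exact h.trans_lt ENNReal.ofReal_lt_top
    refine ⟨(memLp_two_iff_integrable_sq hm).2 (by simpa using hi), ?_⟩
    rw [← ofReal_integral_eq_lintegral_ofReal hi hn] at h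
    exact (ENNReal.ofReal_le_ofReal_iff hc).1 h

lemma MeanSquareLE.of_abs_le (h : MeanSquareLE P g a) (hf : AEStronglyMeasurable f P)
    (hfg : ∀ᵐ ω ∂P, |f ω| ≤ |g ω|) : MeanSquareLE P f a := by
  have hL : MemLp f 2 P := h.1.mono hf (by simpa using hfg)
  refine ⟨hL, (integral_mono_ae (by simpa using hL.integrable_sq) h.integrable_sq ?_).trans h.2⟩
  filter_upwards [hfg] with ω hω
  gcongr

lemma MeanSquareLE.add (hf : MeanSquareLE P f a) (hg : MeanSquareLE P g b) :
    MeanSquareLE P (fun ω => f ω + g ω) (2 * (a + b)) := by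
  have hL : MemLp (fun ω => f ω + g ω) 2 P := hf.1.add hg.1
  refine ⟨hL, ?_⟩
  calc ∫ ω, |f ω + g ω| ^ 2 ∂P ≤ ∫ ω, 2 * (|f ω| ^ 2 + |g ω| ^ 2) ∂P := by
        refine integral_mono (by simpa using hL.integrable_sq)
          ((hf.integrable_sq.add hg.integrable_sq).const_mul 2) fun ω => ?_
        simp only [sq_abs]
        nlinarith [sq_nonneg (f ω - g ω)]
    _ = 2 * (∫ ω, |f ω| ^ 2 ∂P + ∫ ω, |g ω| ^ 2 ∂P) := by
        rw [integral_const_mul, integral_add hf.integrable_sq hg.integrable_sq]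
    _ ≤ 2 * (a + b) := by linarith [hf.2, hg.2]

lemma MeanSquareLE.const_mul (hf : MeanSquareLE P f a) (r : ℝ) :
    MeanSquareLE P (fun ω => r * f ω) (r ^ 2 * a) := by
  refine ⟨hf.1.const_mul r, ?_⟩
  simp only [abs_mul, mul_pow, integral_const_mul, sq_abs r]
  exact mul_le_mul_of_nonneg_left hf.2 (sq_nonneg r)

lemma MeanSquareLE.indicator (hf : MeanSquareLE P f a) {s : Set Ω} (hs : MeasurableSet s) :
    MeanSquareLE P (s.indicator f) a := by
  refine hf.of_abs_le (hf.1.aestronglyMeasurable.indicator hs) (ae_of_all _ fun ω => ?_)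
  by_cases h : ω ∈ s <;> simp [h]

lemma meanSquareLE_sum {m : ℕ} {F : ℕ → Ω → ℝ} (hF : ∀ i < m, MeanSquareLE P (F i) c) :
    MeanSquareLE P (fun ω => ∑ i ∈ Finset.range m, F i ω) (m ^ 2 * c) := by
  have hL : MemLp (fun ω => ∑ i ∈ Finset.range m, F i ω) 2 P :=
    memLp_finsetSum _ fun i hi => (hF i (Finset.mem_range.1 hi)).1
  have hi : ∀ i ∈ Finset.range m, Integrable (fun ω => |F i ω| ^ 2) P :=
    fun i hi => (hF i (Finset.mem_range.1 hi)).integrable_sq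
  refine ⟨hL, ?_⟩
  calc ∫ ω, |∑ i ∈ Finset.range m, F i ω| ^ 2 ∂P
      ≤ ∫ ω, m * ∑ i ∈ Finset.range m, |F i ω| ^ 2 ∂P := by
        refine integral_mono (by simpa using hL.integrable_sq)
          ((integrable_finsetSum _ hi).const_mul _) fun ω => ?_
        simpa using sq_sum_le_card_mul_sum_sq (s := Finset.range m) (f := fun i => F i ω)
    _ = m * ∑ i ∈ Finset.range m, ∫ ω, |F i ω| ^ 2 ∂P := by
        rw [integral_const_mul, integral_finsetSum _ hi]
    _ ≤ m * ∑ i ∈ Finset.range m, c := by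
        gcongr with i hi
        exact (hF i (Finset.mem_range.1 hi)).2
    _ = m ^ 2 * c := by
        rw [Finset.sum_const, Finset.card_range, nsmul_eq_mul]
        ring

/-- Fatou's lemma: mean-square bounds pass to almost sure limits. -/
lemma MeanSquareLE.of_tendsto {F : ℕ → Ω → ℝ} (hF : ∀ k, MeanSquareLE P (F k) c)
    (hlim : ∀ᵐ ω ∂P, Tendsto (fun k => F k ω) atTop (𝓝 (f ω))) : MeanSquareLE P f c := by
  have hc := (hF 0).nonneg
  have hm : ∀ k, AEStronglyMeasurable (F k) P := fun k => (hF k).1.aestronglyMeasurable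
  refine (meanSquareLE_iff_lintegral hc).2 ⟨aestronglyMeasurable_of_tendsto_ae _ hm hlim, ?_⟩
  calc ∫⁻ ω, ENNReal.ofReal (|f ω| ^ 2) ∂P
      = ∫⁻ ω, liminf (fun k => ENNReal.ofReal (|F k ω| ^ 2)) atTop ∂P := by
        refine lintegral_congr_ae ?_
        filter_upwards [hlim] with ω hω
        exact (ENNReal.tendsto_ofReal (hω.abs.pow 2)).liminf_eq.symm
    _ ≤ liminf (fun k => ∫⁻ ω, ENNReal.ofReal (|F k ω| ^ 2) ∂P) atTop :=
        lintegral_liminf_le' fun k => (((hm k).aemeasurable.abs).pow_const 2).ennreal_ofReal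
    _ ≤ liminf (fun _ : ℕ => ENNReal.ofReal c) atTop :=
        liminf_le_liminf (Eventually.of_forall fun k =>
          ((meanSquareLE_iff_lintegral hc).1 (hF k)).2)
    _ = ENNReal.ofReal c := liminf_const _

end MeanSquare

/-! ### Sums against increments of a Wiener process -/

section Wiener

variable {Ω : Type*} [MeasurableSpace Ω] {P : Measure Ω} {T : ℝ}
  {𝓕 : Filtration (Set.Icc (0 : ℝ) T) ‹MeasurableSpace Ω›} {W : ℝ → Ω → ℝ}

lemma IsWiener.memLp (hW : IsWiener P T 𝓕 W) (t : Set.Icc (0 : ℝ) T) : MemLp (W t) 2 P :=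
  (memLp_two_iff_integrable_sq (hW.martingale.integrable t).aestronglyMeasurable).2
    (hW.integrable_sq t)

lemma IsWiener.memLp_sub (hW : IsWiener P T 𝓕 W) (s t : Set.Icc (0 : ℝ) T) :
    MemLp (fun ω => W t ω - W s ω) 2 P :=
  (hW.memLp t).sub (hW.memLp s)

variable [IsProbabilityMeasure P]

lemma IsWiener.integral_mul_sub (hW : IsWiener P T 𝓕 W) {s t : Set.Icc (0 : ℝ) T} (hst : s ≤ t)
    {Z : Ω → ℝ} (hZ : StronglyMeasurable[𝓕 s] Z)
    (hi : Integrable (fun ω => Z ω * (W t ω - W s ω)) P) :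
    ∫ ω, Z ω * (W t ω - W s ω) ∂P = 0 := by
  have hD : P[fun ω => W t ω - W s ω | 𝓕 s] =ᵐ[P] 0 := by
    have h1 := condExp_sub (hW.martingale.integrable t) (hW.martingale.integrable s) (𝓕 s)
    have h2 := hW.martingale.condExp_ae_eq hst
    have h3 := hW.martingale.condExp_ae_eq (le_refl s)
    filter_upwards [h1, h2, h3] with ω h1 h2 h3
    refine h1.trans ?_
    simp [h2, h3]
  have hp := condExp_mul_of_stronglyMeasurable_left (μ := P) (g := fun ω => W t ω - W s ω) hZ hi
    ((hW.memLp_sub s t).integrable (by norm_num))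
  rw [← integral_condExp (𝓕.le s)]
  refine integral_eq_zero_of_ae (hp.trans ?_)
  filter_upwards [hD] with ω hω
  simp [hω]

/-- `E[H² (W(t) - W(s))²] ≤ c (t - s)` if `E[H²] ≤ c`, for `𝓕ₛ`-measurable `H`. It is proved for
bounded `H`, where `H²` can be pulled out of the conditional expectation, and extended by
truncation. -/
lemma IsWiener.meanSquareLE_mul_sub (hW : IsWiener P T 𝓕 W) {s t : Set.Icc (0 : ℝ) T}
    (hst : s ≤ t) {H : Ω → ℝ} (hH : StronglyMeasurable[𝓕 s] H) {c : ℝ}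
    (hc : MeanSquareLE P H c) :
    MeanSquareLE P (fun ω => H ω * (W t ω - W s ω)) (c * (t - s)) := by
  have hst' : (0 : ℝ) ≤ t - s := sub_nonneg.2 hst
  have key : ∀ (K : Ω → ℝ) (R : ℝ), StronglyMeasurable[𝓕 s] K → (∀ ω, |K ω| ≤ R) →
      MeanSquareLE P K c → MeanSquareLE P (fun ω => K ω * (W t ω - W s ω)) (c * (t - s)) := by
    intro K R hK hR hKc
    have htop : MemLp K ⊤ P :=
      memLp_top_of_bound (hK.mono (𝓕.le s)).aestronglyMeasurable R (ae_of_all _ hR)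
    have hL : MemLp (fun ω => K ω * (W t ω - W s ω)) 2 P := MemLp.mul' (hW.memLp_sub s t) htop
    refine ⟨hL, ?_⟩
    have hi : Integrable ((fun ω => K ω ^ 2) * fun ω => (W t ω - W s ω) ^ 2) P :=
      hL.integrable_sq.congr (ae_of_all _ fun ω => by simp [mul_pow])
    have hp := condExp_mul_of_stronglyMeasurable_left (μ := P) (hK.pow 2) hi
      (hW.memLp_sub s t).integrable_sq
    calc ∫ ω, |K ω * (W t ω - W s ω)| ^ 2 ∂P
        = ∫ ω, ((fun ω => K ω ^ 2) * fun ω => (W t ω - W s ω) ^ 2) ω ∂P := by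
          simp [mul_pow]
      _ = ∫ ω, |K ω| ^ 2 * (t - s) ∂P := by
          rw [← integral_condExp (𝓕.le s)]
          refine integral_congr_ae (hp.trans ?_)
          filter_upwards [hW.condVariance s t hst] with ω hω
          simp [hω]
      _ ≤ c * (t - s) := by
          rw [integral_mul_const]
          exact mul_le_mul_of_nonneg_right hKc.2 hst'
  have hset : ∀ k : ℕ, MeasurableSet[𝓕 s] {ω | |H ω| ≤ k} := fun k =>
    (show Measurable[𝓕 s] fun ω => |H ω| from hH.norm.measurable) measurableSet_Iic
  refine MeanSquareLE.of_tendsto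
    (F := fun k ω => {ω | |H ω| ≤ (k : ℝ)}.indicator H ω * (W t ω - W s ω)) (fun k => ?_)
    (ae_of_all _ fun ω => ?_)
  · refine key _ k (hH.indicator (hset k)) (fun ω => ?_) (hc.indicator (𝓕.le s _ (hset k)))
    by_cases h : |H ω| ≤ k <;> simp [Set.indicator, h]
  · refine tendsto_const_nhds.congr' ?_
    filter_upwards [eventually_ge_atTop ⌈|H ω|⌉₊] with k hk
    have : |H ω| ≤ k := (Nat.le_ceil _).trans (by exact_mod_cast hk)
    simp [Set.indicator, this]

/-- The inequality half of the Itô isometry for left-endpoint sums. -/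
lemma IsWiener.meanSquareLE_leftSum (hW : IsWiener P T 𝓕 W) {H : ℝ → Ω → ℝ}
    (hH : StronglyAdapted 𝓕 fun t : Set.Icc (0 : ℝ) T => H t) {r : ℕ → ℝ} (hr : Monotone r)
    {c : ℝ} (m : ℕ) (hrT : ∀ i ≤ m, r i ∈ Set.Icc 0 T)
    (hc : ∀ i < m, MeanSquareLE P (H (r i)) c) :
    MeanSquareLE P (leftSum W H m r) (c * (r m - r 0)) := by
  suffices h : ∀ hm : r m ∈ Set.Icc 0 T, StronglyMeasurable[𝓕 ⟨r m, hm⟩] (leftSum W H m r) ∧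
      MeanSquareLE P (leftSum W H m r) (c * (r m - r 0)) from (h (hrT m le_rfl)).2
  induction m with
  | zero =>
    intro hm
    have h0 : leftSum W H 0 r = fun _ => 0 := by
      funext ω
      simp [leftSum]
    rw [h0]
    exact ⟨stronglyMeasurable_const, by simp, by simp⟩
  | succ m ih =>
    intro hm'
    have hm : r m ∈ Set.Icc 0 T := hrT m (Nat.le_succ m)
    obtain ⟨hS, hSc⟩ := ih (fun i hi => hrT i (hi.trans (Nat.le_succ m)))
      (fun i hi => hc i (hi.trans (Nat.lt_succ_self m))) hm
    let s : Set.Icc (0 : ℝ) T := ⟨r m, hm⟩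
    let t : Set.Icc (0 : ℝ) T := ⟨r (m + 1), hm'⟩
    have hst : s ≤ t := hr (Nat.le_succ m)
    have hHs : StronglyMeasurable[𝓕 s] (H (r m)) := hH s
    have hD := hW.meanSquareLE_mul_sub hst hHs (hc m (Nat.lt_succ_self m))
    have heq : leftSum W H (m + 1) r =
        fun ω => leftSum W H m r ω + H (r m) ω * (W t ω - W s ω) := by
      funext ω
      simp [leftSum, Finset.sum_range_succ, s, t]
    have hcross : Integrable (fun ω => leftSum W H m r ω * (H (r m) ω * (W t ω - W s ω))) P :=
      hSc.1.integrable_mul hD.1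
    have hzero : ∫ ω, leftSum W H m r ω * (H (r m) ω * (W t ω - W s ω)) ∂P = 0 := by
      simp only [← mul_assoc] at hcross ⊢
      exact hW.integral_mul_sub hst (hS.mul hHs) hcross
    rw [heq]
    refine ⟨(hS.mono (𝓕.mono hst)).add ((hHs.mono (𝓕.mono hst)).mul
      ((hW.martingale.1 t).sub ((hW.martingale.1 s).mono (𝓕.mono hst)))), hSc.1.add hD.1, ?_⟩
    calc ∫ ω, |leftSum W H m r ω + H (r m) ω * (W t ω - W s ω)| ^ 2 ∂P
        = ∫ ω, (|leftSum W H m r ω| ^ 2 + |H (r m) ω * (W t ω - W s ω)| ^ 2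
            + 2 * (leftSum W H m r ω * (H (r m) ω * (W t ω - W s ω)))) ∂P := by
          congr 1
          funext ω
          simp only [sq_abs]
          ring
      _ = ∫ ω, |leftSum W H m r ω| ^ 2 ∂P + ∫ ω, |H (r m) ω * (W t ω - W s ω)| ^ 2 ∂P := by
          have hsq : Integrable (fun ω => |leftSum W H m r ω| ^ 2
              + |H (r m) ω * (W t ω - W s ω)| ^ 2) P := hSc.integrable_sq.add hD.integrable_sq
          rw [integral_add hsq (hcross.const_mul 2), integral_add hSc.integrable_sq hD.integrable_sq,
            integral_const_mul, hzero]
          simp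
      _ ≤ c * (r m - r 0) + c * (r (m + 1) - r m) := add_le_add hSc.2 hD.2
      _ = c * (r (m + 1) - r 0) := by ring

end Wiener

/-! ### Left-endpoint sums along uniform partitions -/

/-- The `j`-th point of the partition of `[s, t]` into `k + 1` intervals of equal length. -/
noncomputable def node (s t : ℝ) (k j : ℕ) : ℝ := s + (t - s) * (j / (k + 1))

lemma node_zero (s t : ℝ) (k : ℕ) : node s t k 0 = s := by simp [node]

lemma node_last (s t : ℝ) (k : ℕ) : node s t k (k + 1) = t := by
  have : (k : ℝ) + 1 ≠ 0 := by positivity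
  simp [node, div_self this]

lemma node_succ_sub (s t : ℝ) (k j : ℕ) :
    node s t k (j + 1) - node s t k j = (t - s) / (k + 1) := by
  simp only [node]
  push_cast
  ring

lemma node_monotone {s t : ℝ} (hst : s ≤ t) (k : ℕ) : Monotone (node s t k) := by
  refine monotone_nat_of_le_succ fun j => sub_nonneg.1 ?_
  rw [node_succ_sub]
  exact div_nonneg (sub_nonneg.2 hst) (by positivity)

lemma node_mem {s t : ℝ} (hst : s ≤ t) {k j : ℕ} (hj : j ≤ k + 1) :
    node s t k j ∈ Set.Icc s t := by
  constructor
  · simpa [node_zero] using node_monotone hst k (Nat.zero_le j)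
  · simpa [node_last] using node_monotone hst k hj

/-- Left Riemann sums of a continuous function converge to its integral. They are written as sums
against the increments of the identity process. -/
lemma tendsto_leftSum_integral {Ω : Type*} {X : ℝ → Ω → ℝ} {ω : Ω} {s t : ℝ} (hst : s ≤ t)
    (hX : ContinuousOn (fun r => X r ω) (Set.Icc s t)) :
    Tendsto (fun k : ℕ => leftSum (fun r _ => r) X (k + 1) (node s t k) ω) atTop
      (𝓝 (∫ r in s..t, X r ω)) := by
  rw [Metric.tendsto_atTop]
  intro ε hε
  have huc := isCompact_Icc.uniformContinuousOn_of_continuous hX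
  rw [Metric.uniformContinuousOn_iff] at huc
  have hε' : 0 < ε / (2 * (t - s + 1)) := div_pos hε (by linarith)
  obtain ⟨δ, hδ, hδX⟩ := huc _ hε'
  obtain ⟨K, hK⟩ := exists_nat_gt ((t - s) / δ)
  refine ⟨K, fun k hk => ?_⟩
  have hmesh : (t - s) / (k + 1) < δ := by
    have hk' : (K : ℝ) ≤ k := by exact_mod_cast hk
    rw [div_lt_iff₀ (by positivity)]
    rw [div_lt_iff₀ hδ] at hK
    nlinarith
  have hmem : ∀ j < k + 1, node s t k j ∈ Set.Icc s t ∧ node s t k (j + 1) ∈ Set.Icc s t :=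
    fun j hj => ⟨node_mem hst hj.le, node_mem hst hj⟩
  have hint : ∀ j < k + 1, IntervalIntegrable (fun r => X r ω) volume (node s t k j)
      (node s t k (j + 1)) := fun j hj =>
    (hX.mono (Set.uIcc_subset_Icc (hmem j hj).1 (hmem j hj).2)).intervalIntegrable
  have hsum := intervalIntegral.sum_integral_adjacent_intervals hint
  rw [node_zero, node_last] at hsum
  rw [← hsum, dist_comm, Real.dist_eq, leftSum, ← Finset.sum_sub_distrib]
  calc |∑ j ∈ Finset.range (k + 1), ((∫ r in node s t k j..node s t k (j + 1), X r ω)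
          - X (node s t k j) ω * (node s t k (j + 1) - node s t k j))|
      ≤ ∑ j ∈ Finset.range (k + 1), ε / (2 * (t - s + 1)) * ((t - s) / (k + 1)) := by
        refine (Finset.abs_sum_le_sum_abs _ _).trans (Finset.sum_le_sum fun j hj => ?_)
        have hj := Finset.mem_range.1 hj
        have hle := node_monotone hst k (Nat.le_succ j)
        have hc : X (node s t k j) ω * (node s t k (j + 1) - node s t k j)
            = ∫ r in node s t k j..node s t k (j + 1), X (node s t k j) ω := by
          simp [mul_comm]
        rw [hc, ← intervalIntegral.integral_sub (hint j hj) intervalIntegrable_const]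
        refine (intervalIntegral.norm_integral_le_of_norm_le_const
          (f := fun r => X r ω - X (node s t k j) ω)
          (C := ε / (2 * (t - s + 1))) fun r hr => ?_).trans_eq ?_
        · rw [Set.uIoc_of_le hle] at hr
          have hd := node_succ_sub s t k j
          refine (hδX r ⟨(hmem j hj).1.1.trans hr.1.le, hr.2.trans (hmem j hj).2.2⟩ _
            (hmem j hj).1 ?_).le
          rw [Real.dist_eq, abs_of_nonneg (by linarith [hr.1])]
          linarith [hr.2]
        · rw [abs_of_nonneg (sub_nonneg.2 hle), node_succ_sub]
    _ = ε / 2 * ((t - s) / (t - s + 1)) := by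
        have : (k : ℝ) + 1 ≠ 0 := by positivity
        have : t - s + 1 ≠ 0 := by linarith
        rw [Finset.sum_const, Finset.card_range, nsmul_eq_mul]
        push_cast
        field_simp
    _ < ε := by
        have : (t - s) / (t - s + 1) ≤ 1 := by
          rw [div_le_one (by linarith)]
          linarith
        nlinarith

/-! ### Increments of the solution as limits of sums -/

/-- The sum `∑ X(rⱼ) (μ (rⱼ₊₁ - rⱼ) + σ (W(rⱼ₊₁) - W(rⱼ)))` along the uniform partition of
`[s, t]` into `k + 1` intervals. -/
noncomputable def eulerSum {Ω : Type*} (μ σ : ℝ) (W X : ℝ → Ω → ℝ) (s t : ℝ) (k : ℕ) (ω : Ω) : ℝ :=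
  μ * leftSum (fun r _ => r) X (k + 1) (node s t k) ω + σ * leftSum W X (k + 1) (node s t k) ω

section Solution

variable {Ω : Type*} [MeasurableSpace Ω] {P : Measure Ω} {T μ σ : ℝ}
  {𝓕 : Filtration (Set.Icc (0 : ℝ) T) ‹MeasurableSpace Ω›} {W X : ℝ → Ω → ℝ}

/-- The partitions of `[0, t]` used here pass through `s`, so that their initial parts are
partitions of `[0, s]` and the difference of the two left-endpoint sums is a sum over `[s, t]`. -/
lemma IsSolution.exists_tendsto_eulerSum (hX : IsSolution P T μ σ 𝓕 W X) {s t : ℝ}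
    (hs : 0 ≤ s) (hst : s ≤ t) (ht : t ≤ T) :
    ∃ ns : ℕ → ℕ, ∀ᵐ ω ∂P,
      Tendsto (fun k => eulerSum μ σ W X s t (ns k) ω) atTop (𝓝 (X t ω - X s ω)) := by
  obtain ⟨I, hI, hIeq⟩ := hX.integral_eq s ⟨hs, hst.trans ht⟩
  obtain ⟨J, hJ, hJeq⟩ := hX.integral_eq t ⟨hs.trans hst, ht⟩
  let τ : ℕ → ℕ → ℝ := fun k i =>
    s * ((min i (k + 1) : ℕ) / (k + 1)) + (t - s) * ((i - (k + 1) : ℕ) / (k + 1))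
  have hpos : ∀ k : ℕ, (0 : ℝ) < k + 1 := fun k => by positivity
  have hτ_mono : ∀ k, Monotone (τ k) := by
    intro k i j hij
    have h1 : ((min i (k + 1) : ℕ) : ℝ) ≤ (min j (k + 1) : ℕ) := by
      exact_mod_cast min_le_min_right _ hij
    have h2 : ((i - (k + 1) : ℕ) : ℝ) ≤ (j - (k + 1) : ℕ) := by
      exact_mod_cast Nat.sub_le_sub_right hij _
    have h3 := sub_nonneg.2 hst
    simp only [τ]
    gcongr
  have hτ_zero : ∀ k, τ k 0 = 0 := fun k => by simp [τ, (hpos k).le]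
  have hτ_add : ∀ k j, τ k (k + 1 + j) = node s t k j := by
    intro k j
    have h1 : min (k + 1 + j) (k + 1) = k + 1 := by omega
    have h2 : k + 1 + j - (k + 1) = j := by omega
    simp only [τ, node, h1, h2]
    push_cast
    rw [div_self (hpos k).ne', mul_one]
  have hτ_mid : ∀ k, τ k (k + 1) = s := fun k => by
    simpa [node_zero] using hτ_add k 0
  have hτ_last : ∀ k, τ k (k + 1 + (k + 1)) = t := fun k => by
    rw [hτ_add, node_last]
  have hτ_mesh : ∀ k i, τ k (i + 1) - τ k i ≤ t * (1 / (k + 1)) := by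
    intro k i
    have h1 : ((min (i + 1) (k + 1) : ℕ) : ℝ) ≤ (min i (k + 1) : ℕ) + 1 := by
      have : min (i + 1) (k + 1) ≤ min i (k + 1) + 1 := by omega
      exact_mod_cast this
    have h2 : ((i + 1 - (k + 1) : ℕ) : ℝ) ≤ (i - (k + 1) : ℕ) + 1 := by
      have : i + 1 - (k + 1) ≤ i - (k + 1) + 1 := by omega
      exact_mod_cast this
    have h3 := sub_nonneg.2 hst
    calc τ k (i + 1) - τ k i
        ≤ s * (((min i (k + 1) : ℕ) + 1) / (k + 1))
          + (t - s) * (((i - (k + 1) : ℕ) + 1) / (k + 1)) - τ k i := by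
          simp only [τ]
          gcongr
      _ = t * (1 / (k + 1)) := by
          simp only [τ]
          ring
  have hmesh0 : Tendsto (fun k : ℕ => t * (1 / ((k : ℝ) + 1))) atTop (𝓝 0) := by
    simpa using (tendsto_one_div_add_atTop_nhds_zero_nat (𝕜 := ℝ)).const_mul t
  have hIlim := hI (fun k => k + 1) τ _ (fun k => ⟨hτ_mono k, hτ_zero k, hτ_mid k⟩)
    (fun k i _ => hτ_mesh k i) hmesh0
  have hJlim := hJ (fun k => k + 1 + (k + 1)) τ _
    (fun k => ⟨hτ_mono k, hτ_zero k, hτ_last k⟩) (fun k i _ => hτ_mesh k i) hmesh0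
  obtain ⟨ns, hns, hIae⟩ := hIlim.exists_seq_tendsto_ae
  obtain ⟨ms, hms, hJae⟩ := (hJlim.comp hns.tendsto_atTop).exists_seq_tendsto_ae
  refine ⟨ns ∘ ms, ?_⟩
  filter_upwards [hIae, hJae, hIeq, hJeq, hX.continuous_paths] with ω hIω hJω hIe hJe hc
  have hint : ∀ {a b : ℝ}, 0 ≤ a → a ≤ T → 0 ≤ b → b ≤ T →
      IntervalIntegrable (fun r => μ * X r ω) volume a b := fun ha ha' hb hb' =>
    ((hc.mono (Set.uIcc_subset_Icc ⟨ha, ha'⟩ ⟨hb, hb'⟩)).const_smul μ).intervalIntegrable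
  have hT := (hs.trans hst).trans ht
  have hdrift := intervalIntegral.integral_interval_sub_left
    (hint le_rfl hT (hs.trans hst) ht) (hint le_rfl hT hs (hst.trans ht))
  have hR := ((tendsto_leftSum_integral hst (hc.mono (Set.Icc_subset_Icc hs ht))).comp
    ((hns.comp hms).tendsto_atTop)).const_mul μ
  have hlim := hR.add (hJω.sub (hIω.comp hms.tendsto_atTop))
  have hval : X t ω - X s ω = μ * (∫ r in s..t, X r ω) + (J ω - I ω) := by
    rw [hIe, hJe, ← intervalIntegral.integral_const_mul, ← hdrift]
    ring
  rw [hval]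
  refine hlim.congr fun k => ?_
  simp only [Function.comp_apply, eulerSum, leftSum]
  rw [Finset.sum_range_add _ (ns (ms k) + 1) (ns (ms k) + 1), add_sub_cancel_left]
  congr 1
  rw [Finset.mul_sum]
  refine Finset.sum_congr rfl fun j _ => ?_
  rw [add_assoc _ j 1, hτ_add, hτ_add]
  ring

/-! ### Truncation of the solution -/

/-- The event that the path of `X` stays in `[-R, R]` up to time `t`. Only rational times are
tested, which keeps the event measurable and, for continuous paths, loses nothing. -/
def staysBelow (X : ℝ → Ω → ℝ) (R t : ℝ) : Set Ω :=
  {ω | ∀ q : ℚ, (q : ℝ) ∈ Set.Icc 0 t → |X q ω| ≤ R}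

/-- The process `X`, set to `0` once its path has left `[-R, R]`. -/
noncomputable def trunc (X : ℝ → Ω → ℝ) (R t : ℝ) : Ω → ℝ := (staysBelow X R t).indicator (X t)

omit [MeasurableSpace Ω] in
lemma staysBelow_anti (X : ℝ → Ω → ℝ) (R : ℝ) {s t : ℝ} (hst : s ≤ t) :
    staysBelow X R t ⊆ staysBelow X R s :=
  fun _ h q hq => h q ⟨hq.1, hq.2.trans hst⟩

lemma IsSolution.measurableSet_staysBelow (hX : IsSolution P T μ σ 𝓕 W X) (R : ℝ)
    (t : Set.Icc (0 : ℝ) T) : MeasurableSet[𝓕 t] (staysBelow X R t) := by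
  have h : staysBelow X R t = ⋂ q : ℚ, {ω | (q : ℝ) ∈ Set.Icc (0 : ℝ) t → |X q ω| ≤ R} := by
    ext ω
    simp [staysBelow]
  rw [h]
  refine MeasurableSet.iInter fun q => ?_
  by_cases hq : (q : ℝ) ∈ Set.Icc (0 : ℝ) t
  · simp only [hq, true_imp_iff]
    let u : Set.Icc (0 : ℝ) T := ⟨q, hq.1, hq.2.trans t.2.2⟩
    exact 𝓕.mono (show u ≤ t from hq.2) _ ((hX.adapted u).norm.measurable measurableSet_Iic)
  · simp [hq]

lemma IsSolution.stronglyAdapted_trunc (hX : IsSolution P T μ σ 𝓕 W X) (R : ℝ) :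
    StronglyAdapted 𝓕 fun t : Set.Icc (0 : ℝ) T => trunc X R t :=
  fun t => (hX.adapted t).indicator (hX.measurableSet_staysBelow R t)

lemma IsSolution.aestronglyMeasurable (hX : IsSolution P T μ σ 𝓕 W X) {t : ℝ}
    (ht : t ∈ Set.Icc 0 T) : AEStronglyMeasurable (X t) P :=
  ((hX.adapted ⟨t, ht⟩).mono (𝓕.le _)).aestronglyMeasurable

lemma IsSolution.measurableSet_staysBelow' (hX : IsSolution P T μ σ 𝓕 W X) (R : ℝ) {t : ℝ}
    (ht : t ∈ Set.Icc 0 T) : MeasurableSet (staysBelow X R t) :=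
  𝓕.le _ _ (hX.measurableSet_staysBelow R ⟨t, ht⟩)

lemma IsSolution.abs_trunc_le (hX : IsSolution P T μ σ 𝓕 W X) {R : ℝ} (hR : 0 ≤ R) {t : ℝ}
    (ht : t ∈ Set.Icc 0 T) : ∀ᵐ ω ∂P, |trunc X R t ω| ≤ R := by
  filter_upwards [hX.continuous_paths] with ω hc
  by_cases hω : ω ∈ staysBelow X R t
  swap
  · simpa [trunc, hω] using hR
  rw [trunc, Set.indicator_of_mem hω]
  by_contra! hlt
  have ht0 : 0 < t := by
    rcases ht.1.eq_or_lt with h | h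
    · have h0 := hω 0 (by simp [← h])
      rw [Rat.cast_zero, h] at h0
      linarith
    · exact h
  have hcl : ContinuousWithinAt (fun r => |X r ω|) (Set.Icc 0 T) t := (hc t ht).abs
  obtain ⟨δ, hδ, hδX⟩ := Metric.mem_nhdsWithin_iff.1 (hcl.eventually (lt_mem_nhds hlt))
  obtain ⟨q, hq, hqt⟩ := exists_rat_btwn (max_lt ht0 (sub_lt_self t hδ))
  obtain ⟨hq0, hqδ⟩ := max_lt_iff.1 hq
  have hq' : (q : ℝ) ∈ Metric.ball t δ := by
    rw [Metric.mem_ball, Real.dist_eq, abs_lt]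
    constructor <;> linarith
  have h1 : R < |X q ω| := hδX ⟨hq', hq0.le, hqt.le.trans ht.2⟩
  exact absurd (hω q ⟨hq0.le, hqt.le⟩) (not_le.2 h1)

lemma IsSolution.eventually_mem_staysBelow (hX : IsSolution P T μ σ 𝓕 W X) {t : ℝ} (ht : t ≤ T) :
    ∀ᵐ ω ∂P, ∀ᶠ k : ℕ in atTop, ω ∈ staysBelow X k t := by
  filter_upwards [hX.continuous_paths] with ω hc
  obtain ⟨C, hC⟩ := isCompact_Icc.exists_bound_of_continuousOn hc
  filter_upwards [eventually_ge_atTop ⌈C⌉₊] with k hk q hq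
  exact (hC q ⟨hq.1, hq.2.trans ht⟩).trans ((Nat.le_ceil C).trans (by exact_mod_cast hk))

/-- Mean-square bounds that hold on `staysBelow X k t` for all `k` hold without restriction. -/
lemma IsSolution.meanSquareLE_of_indicator (hX : IsSolution P T μ σ 𝓕 W X) {t c : ℝ} (ht : t ≤ T)
    {f : Ω → ℝ} (hf : ∀ k : ℕ, MeanSquareLE P ((staysBelow X k t).indicator f) c) :
    MeanSquareLE P f c := by
  refine MeanSquareLE.of_tendsto hf ?_
  filter_upwards [hX.eventually_mem_staysBelow ht] with ω hω
  refine tendsto_const_nhds.congr' ?_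
  filter_upwards [hω] with k hk
  rw [Set.indicator_of_mem hk]

end Solution

/-! ### Second moments of the solution and of its increments -/

section Moments

variable {Ω : Type*} [MeasurableSpace Ω] {P : Measure Ω} [IsProbabilityMeasure P] {T μ σ : ℝ}
  {𝓕 : Filtration (Set.Icc (0 : ℝ) T) ‹MeasurableSpace Ω›} {W X : ℝ → Ω → ℝ}

lemma IsWiener.meanSquareLE_eulerSum (hW : IsWiener P T 𝓕 W) {H : ℝ → Ω → ℝ}
    (hH : StronglyAdapted 𝓕 fun t : Set.Icc (0 : ℝ) T => H t) {s t : ℝ}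
    (hs : 0 ≤ s) (hst : s ≤ t) (ht : t ≤ T) {c : ℝ}
    (hc : ∀ r ∈ Set.Icc s t, MeanSquareLE P (H r) c) (k : ℕ) :
    MeanSquareLE P (eulerSum μ σ W H s t k) (2 * (μ ^ 2 * T + σ ^ 2) * (t - s) * c) := by
  have hc0 : 0 ≤ c := (hc s ⟨le_rfl, hst⟩).nonneg
  have hmem : ∀ j ≤ k + 1, node s t k j ∈ Set.Icc s t := fun j hj => node_mem hst hj
  have hdrift : MeanSquareLE P (leftSum (fun r _ => r) H (k + 1) (node s t k))
      ((t - s) ^ 2 * c) := by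
    have h : ∀ j < k + 1, MeanSquareLE P (fun ω => H (node s t k j) ω * ((t - s) / (k + 1)))
        (((t - s) / (k + 1)) ^ 2 * c) := fun j hj => by
      simpa only [mul_comm] using (hc _ (hmem j hj.le)).const_mul ((t - s) / (k + 1))
    have hsum := meanSquareLE_sum h
    have hk : (k : ℝ) + 1 ≠ 0 := by positivity
    have hval : ((k + 1 : ℕ) : ℝ) ^ 2 * (((t - s) / (k + 1)) ^ 2 * c) = (t - s) ^ 2 * c := by
      push_cast
      field_simp
    rw [hval] at hsum
    refine hsum.congr (ae_of_all _ fun ω => ?_)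
    simp only [leftSum, node_succ_sub]
  have hnoise := hW.meanSquareLE_leftSum hH (node_monotone hst k) (k + 1)
    (fun j hj => Set.Icc_subset_Icc hs ht (hmem j hj)) (fun j hj => hc _ (hmem j hj.le))
  rw [node_zero, node_last] at hnoise
  refine ((hdrift.const_mul μ).add (hnoise.const_mul σ)).mono ?_
  have h1 : (t - s) * ((t - s) * c) ≤ T * ((t - s) * c) :=
    mul_le_mul_of_nonneg_right (by linarith) (mul_nonneg (sub_nonneg.2 hst) hc0)
  nlinarith [mul_le_mul_of_nonneg_left h1 (sq_nonneg μ)]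

/-- On `staysBelow X R t` the sums approximating `X t - X s` do not see the truncation. -/
lemma IsSolution.meanSquareLE_indicator_sub (hX : IsSolution P T μ σ 𝓕 W X)
    (hW : IsWiener P T 𝓕 W) {s t : ℝ} (hs : 0 ≤ s) (hst : s ≤ t) (ht : t ≤ T) {R c : ℝ}
    (hc : ∀ r ∈ Set.Icc s t, MeanSquareLE P (trunc X R r) c) :
    MeanSquareLE P ((staysBelow X R t).indicator fun ω => X t ω - X s ω)
      (2 * (μ ^ 2 * T + σ ^ 2) * (t - s) * c) := by
  obtain ⟨ns, hns⟩ := hX.exists_tendsto_eulerSum hs hst ht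
  have hmeas := hX.measurableSet_staysBelow' R ⟨hs.trans hst, ht⟩
  refine MeanSquareLE.of_tendsto (F := fun k => (staysBelow X R t).indicator
    (eulerSum μ σ W (trunc X R) s t (ns k)))
    (fun k => (hW.meanSquareLE_eulerSum (hX.stronglyAdapted_trunc R) hs hst ht hc _).indicator
      hmeas) ?_
  filter_upwards [hns] with ω hω
  by_cases h : ω ∈ staysBelow X R t
  swap
  · simp [h]
  simp only [Set.indicator_of_mem h]
  refine hω.congr fun k => ?_
  have hval : ∀ j < ns k + 1,
      trunc X R (node s t (ns k) j) ω = X (node s t (ns k) j) ω := fun j hj =>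
    Set.indicator_of_mem (staysBelow_anti X R (node_mem hst hj.le).2 h) _
  simp only [eulerSum, leftSum]
  congr 2 <;>
  · refine Finset.sum_congr rfl fun j hj => ?_
    rw [hval j (Finset.mem_range.1 hj)]

lemma IsSolution.memLp_trunc (hX : IsSolution P T μ σ 𝓕 W X) {R : ℝ} (hR : 0 ≤ R) {t : ℝ}
    (ht : t ∈ Set.Icc 0 T) : MemLp (trunc X R t) 2 P :=
  MemLp.of_bound ((hX.aestronglyMeasurable ht).indicator (hX.measurableSet_staysBelow' R ht)) R
    (hX.abs_trunc_le hR ht)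

/-- Over a time interval so short that `8 (μ² T + σ²) (t - s) ≤ 1`, the second moment of the
truncated solution grows at most by the factor `4`. -/
lemma IsSolution.meanSquareLE_trunc_step (hX : IsSolution P T μ σ 𝓕 W X)
    (hW : IsWiener P T 𝓕 W) {s t : ℝ} (hs : 0 ≤ s) (hst : s ≤ t) (ht : t ≤ T)
    (hshort : 8 * (μ ^ 2 * T + σ ^ 2) * (t - s) ≤ 1) {R b : ℝ} (hR : 0 ≤ R)
    (hb : MeanSquareLE P (trunc X R s) b) : MeanSquareLE P (trunc X R t) (4 * b) := by
  have hT : 0 ≤ T := (hs.trans hst).trans ht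
  have hmem : ∀ r ∈ Set.Icc s t, r ∈ Set.Icc 0 T := fun r hr => Set.Icc_subset_Icc hs ht hr
  let g : ℝ → ℝ := fun r => ∫ ω, |trunc X R r ω| ^ 2 ∂P
  have hgR : ∀ r ∈ Set.Icc s t, g r ≤ R ^ 2 := by
    intro r hr
    calc g r ≤ ∫ _, R ^ 2 ∂P := by
          refine integral_mono_ae (by simpa using (hX.memLp_trunc hR (hmem r hr)).integrable_sq)
            (integrable_const _) ?_
          filter_upwards [hX.abs_trunc_le hR (hmem r hr)] with ω hω
          gcongr
      _ = R ^ 2 := by simp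
  -- The supremum is finite because of the truncation; this is what permits its absorption below.
  let c : ℝ := sSup (g '' Set.Icc s t)
  have hbdd : BddAbove (g '' Set.Icc s t) := ⟨R ^ 2, by rintro _ ⟨r, hr, rfl⟩; exact hgR r hr⟩
  have hgc : ∀ r ∈ Set.Icc s t, g r ≤ c := fun r hr => le_csSup hbdd ⟨r, hr, rfl⟩
  have hc : ∀ r ∈ Set.Icc s t, MeanSquareLE P (trunc X R r) c := fun r hr =>
    ⟨hX.memLp_trunc hR (hmem r hr), hgc r hr⟩
  have hc0 : 0 ≤ c := (hc s ⟨le_rfl, hst⟩).nonneg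
  have hle : c ≤ 2 * b + c / 2 := by
    refine csSup_le ((Set.nonempty_Icc.2 hst).image g) ?_
    rintro _ ⟨r, hr, rfl⟩
    have h1 : MeanSquareLE P ((staysBelow X R r).indicator (X s)) b := by
      refine hb.of_abs_le ((hX.aestronglyMeasurable (hmem s ⟨le_rfl, hst⟩)).indicator
        (hX.measurableSet_staysBelow' R (hmem r hr))) (ae_of_all _ fun ω => ?_)
      by_cases h : ω ∈ staysBelow X R r
      · simp [trunc, h, staysBelow_anti X R hr.1 h]
      · simp [h]
    have h2 := hX.meanSquareLE_indicator_sub hW hs hr.1 (hr.2.trans ht)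
      (fun u hu => hc u ⟨hu.1, hu.2.trans hr.2⟩)
    have h3 : MeanSquareLE P (trunc X R r) _ := (h1.add h2).congr (ae_of_all _ fun ω => by
      by_cases h : ω ∈ staysBelow X R r <;> simp [trunc, h])
    refine h3.2.trans ?_
    have h4 : 8 * (μ ^ 2 * T + σ ^ 2) * (r - s) ≤ 1 :=
      (mul_le_mul_of_nonneg_left (by linarith [hr.2]) (by positivity)).trans hshort
    nlinarith [mul_le_mul_of_nonneg_right h4 hc0]
  exact (hc t ⟨hst, le_rfl⟩).mono (by linarith)

lemma IsSolution.exists_meanSquareLE_trunc (hX : IsSolution P T μ σ 𝓕 W X)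
    (hW : IsWiener P T 𝓕 W) (hT : 0 ≤ T) (hX0 : MemLp (X 0) 2 P) :
    ∃ C, ∀ R : ℝ, 0 ≤ R → ∀ t ∈ Set.Icc 0 T, MeanSquareLE P (trunc X R t) C := by
  obtain ⟨N, hN⟩ := exists_nat_ge (8 * (μ ^ 2 * T + σ ^ 2) * T)
  let h : ℝ := T / (N + 1)
  have hh : 0 ≤ h := by positivity
  have hshort : 8 * (μ ^ 2 * T + σ ^ 2) * h ≤ 1 := by
    have : 8 * (μ ^ 2 * T + σ ^ 2) * h = 8 * (μ ^ 2 * T + σ ^ 2) * T / (N + 1) := by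
      simp only [h]
      ring
    rw [this, div_le_one (by positivity)]
    linarith
  let b : ℝ := ∫ ω, |X 0 ω| ^ 2 ∂P
  have hb : 0 ≤ b := integral_nonneg fun _ => by positivity
  refine ⟨4 ^ (N + 1) * b, fun R hR t ht => ?_⟩
  have key : ∀ n : ℕ, ∀ t ∈ Set.Icc 0 T, t ≤ n * h → MeanSquareLE P (trunc X R t) (4 ^ n * b) := by
    intro n
    induction n with
    | zero =>
      intro t ht htn
      have h0 : t = 0 := le_antisymm (by simpa using htn) ht.1
      subst h0
      have hX0b : MeanSquareLE P (X 0) b := ⟨hX0, le_rfl⟩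
      simpa [trunc] using hX0b.indicator (hX.measurableSet_staysBelow' R ht)
    | succ n ih =>
      intro t ht htn
      push_cast at htn
      rcases le_total t (n * h) with hle | hle
      · refine (ih t ht hle).mono ?_
        gcongr <;> norm_num
      · have hnh : 0 ≤ n * h := by positivity
        have hs : MeanSquareLE P (trunc X R (n * h)) (4 ^ n * b) :=
          ih _ ⟨hnh, hle.trans ht.2⟩ le_rfl
        have hlen : 8 * (μ ^ 2 * T + σ ^ 2) * (t - n * h) ≤ 1 :=
          (mul_le_mul_of_nonneg_left (by linarith) (by positivity)).trans hshort
        exact (hX.meanSquareLE_trunc_step hW hnh hle ht.2 hlen hR hs).mono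
          (le_of_eq (by ring))
  refine key (N + 1) t ht (ht.2.trans_eq ?_)
  have : (N : ℝ) + 1 ≠ 0 := by positivity
  simp only [h]
  push_cast
  field_simp

/-- The estimates of the solution from which consistency follows: bounded second moments, mean
square increments of the order of the time step, and the same order for the noise term of a step
started at time `s`. -/
theorem IsSolution.exists_moment_bounds (hX : IsSolution P T μ σ 𝓕 W X)
    (hW : IsWiener P T 𝓕 W) (hT : 0 ≤ T) (hX0 : MemLp (X 0) 2 P) :
    ∃ C, 0 ≤ C ∧ ∀ s t : ℝ, 0 ≤ s → s ≤ t → t ≤ T →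
      MeanSquareLE P (X s) C ∧
      MeanSquareLE P (fun ω => X t ω - X s ω) (C * (t - s)) ∧
      MeanSquareLE P (fun ω => X s ω * (W t ω - W s ω)) (C * (t - s)) := by
  obtain ⟨C, hC⟩ := hX.exists_meanSquareLE_trunc hW hT hX0
  have hC0 : 0 ≤ C := (hC 0 le_rfl 0 ⟨le_rfl, hT⟩).nonneg
  let K : ℝ := 2 * (μ ^ 2 * T + σ ^ 2)
  have hK : 0 ≤ K := by positivity
  have hCK : C ≤ (1 + K) * C := by nlinarith [mul_nonneg hK hC0]
  refine ⟨(1 + K) * C, by positivity, fun s t hs hst ht => ?_⟩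
  have hst' := sub_nonneg.2 hst
  have hXs : MeanSquareLE P (X s) C :=
    hX.meanSquareLE_of_indicator (hst.trans ht) fun k => hC k (by positivity) s ⟨hs, hst.trans ht⟩
  have hinc : MeanSquareLE P (fun ω => X t ω - X s ω) (K * (t - s) * C) :=
    hX.meanSquareLE_of_indicator ht fun k => hX.meanSquareLE_indicator_sub hW hs hst ht
      fun r hr => hC k (by positivity) r (Set.Icc_subset_Icc hs ht hr)
  have hnoise := hW.meanSquareLE_mul_sub (s := ⟨s, hs, hst.trans ht⟩) (t := ⟨t, hs.trans hst, ht⟩)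
    hst (hX.adapted _) hXs
  refine ⟨hXs.mono hCK, hinc.mono ?_, hnoise.mono (mul_le_mul_of_nonneg_right hCK hst')⟩
  nlinarith [mul_nonneg hC0 hst']

end Moments

/-! ### The local errors -/

section Scheme

variable {Ω : Type*}

/-- Simpson's rule for the interpolating polynomial. -/
lemma integral_interp {Δt : ℝ} (hΔ : Δt ≠ 0) (X : ℝ → Ω → ℝ) (n : ℕ) (ω : Ω) :
    ∫ t in (grid Δt (2 * n))..(grid Δt (2 * n + 2)), interp Δt X n ω t =
      Δt / 3 * (X (grid Δt (2 * n)) ω + 4 * X (grid Δt (2 * n + 1)) ω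
        + X (grid Δt (2 * n + 2)) ω) := by
  set p := grid Δt (2 * n) with hp
  have h1 : grid Δt (2 * n + 1) = p + Δt := by
    simp only [hp, grid]
    push_cast
    ring
  have h2 : grid Δt (2 * n + 2) = p + 2 * Δt := by
    simp only [hp, grid]
    push_cast
    ring
  rw [h1, h2]
  set x := X p ω with hx
  set y := X (p + Δt) ω with hy
  set z := X (p + 2 * Δt) ω with hz
  have hq : ∀ t, interp Δt X n ω t = (fun u => x + (4 * y - 3 * x - z) / (2 * Δt) * u
      + (x - 2 * y + z) / (2 * Δt ^ 2) * u ^ 2) (t - p) := by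
    intro t
    simp only [interp, ← hp, h1, h2, ← hx, ← hy, ← hz]
    field_simp
    ring
  simp only [hq]
  rw [intervalIntegral.integral_comp_sub_right (fun u => x + (4 * y - 3 * x - z) / (2 * Δt) * u
    + (x - 2 * y + z) / (2 * Δt ^ 2) * u ^ 2), sub_self, add_sub_cancel_left,
    intervalIntegral.integral_add, intervalIntegral.integral_add]
  · have hlin : ∀ r : ℝ, ∫ u in (0 : ℝ)..(2 * Δt), r * u = r * ((2 * Δt) ^ 2 / 2) := fun r => by
      rw [intervalIntegral.integral_const_mul, integral_id]
      ring
    simp only [intervalIntegral.integral_const, hlin, intervalIntegral.integral_const_mul,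
      integral_pow, smul_eq_mul]
    push_cast
    field_simp
    ring
  all_goals exact Continuous.intervalIntegrable (by fun_prop) _ _

lemma abs_mul_le_mul {x y p q : ℝ} (hx : |x| ≤ p) (hy : |y| ≤ q) : |x * y| ≤ p * q := by
  rw [abs_mul]
  exact mul_le_mul hx hy (abs_nonneg y) ((abs_nonneg x).trans hx)

/-- `f` is a linear combination, with deterministic coefficients at most `M` in absolute value, of
the increments of `X` from `t₂ₙ` to `t₂ₙ₊₁` and `t₂ₙ₊₂`, of `Δt X(t₂ₙ)`, and of `X(t₂ₙ)` times the
two increments of `W`. -/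
def IsErrorCombination (Δt : ℝ) (W X : ℝ → Ω → ℝ) (n : ℕ) (M : ℝ) (f : Ω → ℝ) : Prop :=
  ∃ a b c d e : ℝ, |a| ≤ M ∧ |b| ≤ M ∧ |c| ≤ M ∧ |d| ≤ M ∧ |e| ≤ M ∧ ∀ ω, f ω =
    a * (X (grid Δt (2 * n + 1)) ω - X (grid Δt (2 * n)) ω)
    + b * (X (grid Δt (2 * n + 2)) ω - X (grid Δt (2 * n)) ω)
    + c * (Δt * X (grid Δt (2 * n)) ω)
    + d * (X (grid Δt (2 * n)) ω * incr1 Δt W n ω)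
    + e * (X (grid Δt (2 * n)) ω * incr2 Δt W n ω)

lemma IsErrorCombination.meanSquareLE [MeasurableSpace Ω] {P : Measure Ω} {Δt : ℝ}
    {W X : ℝ → Ω → ℝ} {n : ℕ} {M L : ℝ} {f : Ω → ℝ} (hf : IsErrorCombination Δt W X n M f)
    (h₁ : MeanSquareLE P (fun ω => X (grid Δt (2 * n + 1)) ω - X (grid Δt (2 * n)) ω) L)
    (h₂ : MeanSquareLE P (fun ω => X (grid Δt (2 * n + 2)) ω - X (grid Δt (2 * n)) ω) L)
    (h₃ : MeanSquareLE P (fun ω => Δt * X (grid Δt (2 * n)) ω) L)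
    (h₄ : MeanSquareLE P (fun ω => X (grid Δt (2 * n)) ω * incr1 Δt W n ω) L)
    (h₅ : MeanSquareLE P (fun ω => X (grid Δt (2 * n)) ω * incr2 Δt W n ω) L) :
    MeanSquareLE P f (46 * M ^ 2 * L) := by
  obtain ⟨a, b, c, d, e, ha, hb, hc, hd, he, hfeq⟩ := hf
  have hL := h₁.nonneg
  have key : ∀ {r : ℝ} {g : Ω → ℝ}, |r| ≤ M → MeanSquareLE P g L →
      MeanSquareLE P (fun ω => r * g ω) (M ^ 2 * L) := fun hr hg =>
    (hg.const_mul _).mono (mul_le_mul_of_nonneg_right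
      (sq_le_sq.2 (hr.trans (le_abs_self M))) hL)
  rw [funext hfeq]
  exact (((((key ha h₁).add (key hb h₂)).add (key hc h₃)).add (key hd h₄)).add
    (key he h₅)).mono (le_of_eq (by ring))

variable {μ σ Δt : ℝ}

lemma one_fourth_le_denom (a : ℝ) : 1 / 4 ≤ 1 - a + a ^ 2 / 3 := by
  nlinarith [sq_nonneg (a - 3 / 2)]

lemma abs_inv_denom_le (a : ℝ) : |(1 - a + a ^ 2 / 3)⁻¹| ≤ 4 := by
  have h := one_fourth_le_denom a
  rw [abs_of_nonneg (inv_nonneg.2 (by linarith))]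
  calc (1 - a + a ^ 2 / 3)⁻¹ ≤ (1 / 4)⁻¹ := inv_anti₀ (by norm_num) h
    _ = 4 := by norm_num

/-- The numerator of `αₙ - 1` is of first order, which is why `αₙ - 1` contributes only terms of
the order of `Δt` and of the increments of `W`. -/
lemma alpha_eq (W : ℝ → Ω → ℝ) (n : ℕ) (ω : Ω) :
    alpha μ σ Δt W n ω = 1
      + μ * ((1 - μ * Δt / 2) * (1 - μ * Δt + (μ * Δt) ^ 2 / 3)⁻¹) * Δt
      + σ * ((1 - μ * Δt / 3) * (1 - μ * Δt + (μ * Δt) ^ 2 / 3)⁻¹) * incr1 Δt W n ω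
      + σ * (-(μ * Δt) / 12 * (1 - μ * Δt + (μ * Δt) ^ 2 / 3)⁻¹) * incr2 Δt W n ω := by
  have h : 1 - μ * Δt + (μ * Δt) ^ 2 / 3 ≠ 0 := by
    have := one_fourth_le_denom (μ * Δt)
    linarith
  have h' := mul_inv_cancel₀ h
  rw [alpha, div_eq_mul_inv]
  linear_combination h'

variable (ha : |μ * Δt| ≤ 1)
include ha

lemma isErrorCombination_stepError1 (W X : ℝ → Ω → ℝ) (n : ℕ) :
    IsErrorCombination Δt W X n (15 * (1 + |μ| + |σ|)) (stepError1 μ σ Δt W X n) := by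
  have hμ := abs_nonneg μ
  have hσ := abs_nonneg σ
  have hu := abs_inv_denom_le (μ * Δt)
  have ha' := abs_le.1 ha
  refine ⟨1, 0, -(μ * ((1 - μ * Δt / 2) * (1 - μ * Δt + (μ * Δt) ^ 2 / 3)⁻¹)),
    -(σ * ((1 - μ * Δt / 3) * (1 - μ * Δt + (μ * Δt) ^ 2 / 3)⁻¹)),
    -(σ * (-(μ * Δt) / 12 * (1 - μ * Δt + (μ * Δt) ^ 2 / 3)⁻¹)), ?_, ?_, ?_, ?_, ?_, fun ω => ?_⟩
  · rw [abs_one]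
    linarith
  · rw [abs_zero]
    linarith
  · rw [abs_neg]
    refine (abs_mul_le_mul le_rfl (abs_mul_le_mul (p := 3 / 2) ?_ hu)).trans (by linarith)
    rw [abs_le]
    constructor <;> linarith
  · rw [abs_neg]
    refine (abs_mul_le_mul le_rfl (abs_mul_le_mul (p := 4 / 3) ?_ hu)).trans (by linarith)
    rw [abs_le]
    constructor <;> linarith
  · rw [abs_neg]
    refine (abs_mul_le_mul le_rfl (abs_mul_le_mul (p := 1 / 12) ?_ hu)).trans (by linarith)
    rw [abs_le]
    constructor <;> linarith
  · rw [stepError1, alpha_eq]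
    ring

lemma isErrorCombination_stepError2 (W X : ℝ → Ω → ℝ) (n : ℕ) :
    IsErrorCombination Δt W X n (15 * (1 + |μ| + |σ|)) (stepError2 μ σ Δt W X n) := by
  have hμ := abs_nonneg μ
  have hσ := abs_nonneg σ
  have hu := abs_inv_denom_le (μ * Δt)
  have ha' := abs_le.1 ha
  have hv0 : 0 < 1 - μ * Δt / 3 := by linarith
  have hv : |(1 - μ * Δt / 3)⁻¹| ≤ 3 / 2 := by
    rw [abs_of_pos (inv_pos.2 hv0)]
    calc (1 - μ * Δt / 3)⁻¹ ≤ (2 / 3)⁻¹ := inv_anti₀ (by norm_num) (by linarith)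
      _ = 3 / 2 := by norm_num
  set u := (1 - μ * Δt + (μ * Δt) ^ 2 / 3)⁻¹ with hu_def
  set v := (1 - μ * Δt / 3)⁻¹ with hv_def
  have ha2 : |4 * (μ * Δt) / 3| ≤ 4 / 3 := by
    rw [abs_le]
    constructor <;> linarith
  have h1 : |(1 - μ * Δt / 2) * u| ≤ 3 / 2 * 4 := abs_mul_le_mul (by
    rw [abs_le]
    constructor <;> linarith) hu
  have h2 : |(1 - μ * Δt / 3) * u| ≤ 4 / 3 * 4 := abs_mul_le_mul (by
    rw [abs_le]
    constructor <;> linarith) hu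
  have h3 : |-(μ * Δt) / 12 * u| ≤ 1 / 12 * 4 := abs_mul_le_mul (by
    rw [abs_le]
    constructor <;> linarith) hu
  refine ⟨0, 1, -(μ * ((2 + 4 * (μ * Δt) / 3 * ((1 - μ * Δt / 2) * u)) * v)),
    -(σ * (4 * (μ * Δt) / 3 * ((1 - μ * Δt / 3) * u) * v)),
    -(σ * ((1 + 4 * (μ * Δt) / 3 * (-(μ * Δt) / 12 * u)) * v)), ?_, ?_, ?_, ?_, ?_, fun ω => ?_⟩
  · rw [abs_zero]
    linarith
  · rw [abs_one]
    linarith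
  · rw [abs_neg]
    refine (abs_mul_le_mul le_rfl (abs_mul_le_mul (p := 10) ?_ hv)).trans (by linarith)
    have := abs_le.1 (abs_mul_le_mul ha2 h1)
    rw [abs_le]
    constructor <;> linarith
  · rw [abs_neg]
    exact (abs_mul_le_mul le_rfl (abs_mul_le_mul (abs_mul_le_mul ha2 h2) hv)).trans (by linarith)
  · rw [abs_neg]
    refine (abs_mul_le_mul le_rfl (abs_mul_le_mul (p := 2) ?_ hv)).trans (by linarith)
    have := abs_le.1 (abs_mul_le_mul ha2 h3)
    rw [abs_le]
    constructor <;> linarith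
  · have hv1 : (1 - μ * Δt / 3) * v = 1 := mul_inv_cancel₀ hv0.ne'
    rw [stepError2, beta, alpha_eq, div_eq_mul_inv, ← hu_def, ← hv_def]
    linear_combination (-X (grid Δt (2 * n)) ω) * hv1

lemma isErrorCombination_residual1 (W X : ℝ → Ω → ℝ) (n : ℕ) :
    IsErrorCombination Δt W X n (15 * (1 + |μ| + |σ|)) (residual1 μ σ Δt W X n) := by
  have hμ := abs_nonneg μ
  have hσ := abs_nonneg σ
  have ha' := abs_le.1 ha
  refine ⟨1 - 2 * (μ * Δt) / 3, μ * Δt / 12, -μ, -σ, 0, ?_, ?_, ?_, ?_, ?_, fun ω => ?_⟩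
  · rw [abs_le]
    constructor <;> linarith
  · rw [abs_le]
    constructor <;> linarith
  · rw [abs_neg]
    linarith
  · rw [abs_neg]
    linarith
  · rw [abs_zero]
    linarith
  · rw [residual1]
    ring

lemma isErrorCombination_residual2 (hΔ : Δt ≠ 0) (W X : ℝ → Ω → ℝ) (n : ℕ) :
    IsErrorCombination Δt W X n (15 * (1 + |μ| + |σ|)) (residual2 μ σ Δt W X n) := by
  have hμ := abs_nonneg μ
  have hσ := abs_nonneg σ
  have ha' := abs_le.1 ha
  refine ⟨-(4 * (μ * Δt) / 3), 1 - μ * Δt / 3, -(2 * μ), 0, -σ, ?_, ?_, ?_, ?_, ?_, fun ω => ?_⟩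
  · rw [abs_le]
    constructor <;> linarith
  · rw [abs_le]
    constructor <;> linarith
  · rw [abs_neg, abs_mul, abs_two]
    linarith
  · rw [abs_zero]
    linarith
  · rw [abs_neg]
    linarith
  · rw [residual2, integral_interp hΔ]
    ring

end Scheme

end GBM

theorem theorem3p2 {Ω : Type*} [MeasurableSpace Ω] (P : Measure Ω) [IsProbabilityMeasure P]
    (T μ σ : ℝ) (hT : 0 < T)
    (𝓕 : Filtration (Set.Icc (0 : ℝ) T) ‹MeasurableSpace Ω›)
    (W X : ℝ → Ω → ℝ)
    (hW : GBM.IsWiener P T 𝓕 W)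
    (hX : GBM.IsSolution P T μ σ 𝓕 W X)
    (hX0 : MemLp (X 0) 2 P) :
    ∃ k : ℝ, 0 < k ∧ ∃ h₀ : ℝ, 0 < h₀ ∧
      ∀ Δt : ℝ, 0 < Δt → Δt < h₀ → ∀ n : ℕ, GBM.grid Δt (2 * n + 2) ≤ T →
        GBM.MeanSquareLE P (GBM.stepError1 μ σ Δt W X n) (k * Δt) ∧
        GBM.MeanSquareLE P (GBM.stepError2 μ σ Δt W X n) (k * Δt) ∧
        GBM.MeanSquareLE P (GBM.residual1 μ σ Δt W X n) (k * Δt) ∧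
        GBM.MeanSquareLE P (GBM.residual2 μ σ Δt W X n) (k * Δt) := by
  obtain ⟨C, hC0, hC⟩ := hX.exists_moment_bounds hW hT.le hX0
  let M : ℝ := 15 * (1 + |μ| + |σ|)
  refine ⟨46 * M ^ 2 * (2 * C) + 1, by positivity, 1 / (|μ| + 1), by positivity,
    fun Δt hΔ hΔh n hn => ?_⟩
  have hμ := abs_nonneg μ
  have hΔμ : Δt * (|μ| + 1) < 1 := (lt_div_iff₀ (by positivity)).1 hΔh
  have ha : |μ * Δt| ≤ 1 := by
    rw [abs_mul, abs_of_pos hΔ]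
    linarith
  have hΔ1 : Δt ≤ 1 := by nlinarith
  have h0 : 0 ≤ GBM.grid Δt (2 * n) := by
    simp only [GBM.grid]
    positivity
  have h01 : GBM.grid Δt (2 * n + 1) = GBM.grid Δt (2 * n) + Δt := by
    simp only [GBM.grid]
    push_cast
    ring
  have h02 : GBM.grid Δt (2 * n + 2) = GBM.grid Δt (2 * n) + 2 * Δt := by
    simp only [GBM.grid]
    push_cast
    ring
  obtain ⟨hXs, hX1, hW1⟩ := hC (GBM.grid Δt (2 * n)) (GBM.grid Δt (2 * n + 1)) h0
    (by linarith) (by linarith)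
  obtain ⟨-, hX2, hW2⟩ := hC (GBM.grid Δt (2 * n)) (GBM.grid Δt (2 * n + 2)) h0
    (by linarith) hn
  have hCΔ : 0 ≤ C * Δt := by positivity
  have hd1 : C * (GBM.grid Δt (2 * n + 1) - GBM.grid Δt (2 * n)) ≤ 2 * C * Δt := by
    rw [h01]
    linarith
  have hd2 : C * (GBM.grid Δt (2 * n + 2) - GBM.grid Δt (2 * n)) ≤ 2 * C * Δt := by
    rw [h02]
    linarith
  have hd3 : Δt ^ 2 * C ≤ 2 * C * Δt := by nlinarith
  have key : ∀ f : Ω → ℝ, GBM.IsErrorCombination Δt W X n M f →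
      GBM.MeanSquareLE P f ((46 * M ^ 2 * (2 * C) + 1) * Δt) := fun f hf =>
    (hf.meanSquareLE (hX1.mono hd1) (hX2.mono hd2) ((hXs.const_mul Δt).mono hd3)
      (hW1.mono hd1) (hW2.mono hd2)).mono (by linarith)
  exact ⟨key _ (GBM.isErrorCombination_stepError1 ha W X n),
    key _ (GBM.isErrorCombination_stepError2 ha W X n),
    key _ (GBM.isErrorCombination_residual1 ha W X n),
    key _ (GBM.isErrorCombination_residual2 ha hΔ.ne' W X n)⟩
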